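/- Let $\Gamma$ be an ordered (i.e. totally ordered) abelian group, written additively. For ordered abelian groups $A$, $B$ write $A\equiv B$ if $A$ and $B$ are elementarily equivalent in the first-order language $\{0,-,+,\le\}$ of ordered groups, and write $A\oplus B$ for their inverse lexicographic product, i.e. the group $A\times B$ with componentwise addition, ordered by $(a,b)<(a',b')$ if and only if $b<b'$, or $b=b'$ and $a<a'$. Then the following are equivalent: 1. For every prime $p$, $\Gamma$ has a non-trivial convex subgroup that is $p$-divisible. 2. $\Gamma$ is elementarily equivalent to an ordered abelian group $\Gamma'$ which has a non-trivial divisible convex subgroup. 3. $\Gamma\equiv\mathbb{Q}\oplus\Gamma$. 4. $\Gamma\equiv\mathbb{Q}\oplus\Delta$ for some ordered abelian group $\Delta$. -/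

import Mathlib

universe u v w

open scoped FirstOrder

/-- Function symbols of the language of ordered groups: `0`, `-`, `+`. -/
inductive OrderedGroupFunc : ℕ → Type
  | zero : OrderedGroupFunc 0
  | neg : OrderedGroupFunc 1
  | add : OrderedGroupFunc 2

/-- Relation symbols of the language of ordered groups: only `≤`. -/
inductive OrderedGroupRel : ℕ → Type
  | le : OrderedGroupRel 2

/-- The first-order language `{0, -, +, ≤}` of (additively written) ordered groups. -/
def orderedGroupLang : FirstOrder.Language :=
  { Functions := OrderedGroupFunc
    Relations := OrderedGroupRel }

/-- The natural structure for the language of ordered groups, each symbol being interpreted by the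
operation or relation that it denotes. -/
instance orderedGroupStructure (G : Type u) [Zero G] [Neg G] [Add G] [LE G] :
    orderedGroupLang.Structure G where
  funMap := fun {_} f =>
    match f with
    | OrderedGroupFunc.zero => fun _ => 0
    | OrderedGroupFunc.neg => fun x => -x 0
    | OrderedGroupFunc.add => fun x => x 0 + x 1
  RelMap := fun {_} r =>
    match r with
    | OrderedGroupRel.le => fun x => x 0 ≤ x 1

/-- The inverse lexicographic product `A ⊕ B` of two ordered abelian groups: addition is
componentwise, and pairs are compared by their `B`-components first, ties being broken by the
`A`-components. So `A` is a convex subgroup with quotient `B`. Mathlib's `×ₗ` compares first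
components first, so that the two factors are written in the opposite order. -/
abbrev InvLexSum (A : Type u) (B : Type v) : Type (max u v) := B ×ₗ A

/-- `A` is `n`-divisible: every element of `A` is of the form `n • y` with `y` in `A`. -/
def IsNDivisible (n : ℕ) (A : Type u) [AddCommGroup A] : Prop :=
  ∀ x : A, ∃ y : A, n • y = x

/-- `A` is divisible: it is `n`-divisible for every positive integer `n`. -/
def IsDivisibleGroup (A : Type u) [AddCommGroup A] : Prop :=
  ∀ n : ℕ, 0 < n → IsNDivisible n A

/-- `G` has a nontrivial convex subgroup that is `n`-divisible (as a group). -/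
def HasNDivisibleConvexSubgroup (n : ℕ) (G : Type u) [AddCommGroup G] [LinearOrder G] : Prop :=
  ∃ D : AddSubgroup G, D ≠ ⊥ ∧ (D : Set G).OrdConnected ∧ IsNDivisible n D

/-- `G` has a nontrivial convex subgroup that is divisible (as a group). -/
def HasDivisibleConvexSubgroup (G : Type u) [AddCommGroup G] [LinearOrder G] : Prop :=
  ∃ D : AddSubgroup G, D ≠ ⊥ ∧ (D : Set G).OrdConnected ∧ IsDivisibleGroup D

/-!
The equivalence rests on comparing an ordered abelian group `Γ` with `ℚ ⊕ Γ` one formula at a time,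
which avoids saturated models and the splitting off of divisible subgroups.

The first condition, for the primes dividing `N !`, gives a nontrivial convex subgroup `D` of `Γ`
that is `N !`-divisible: `p`-divisibility of a convex subgroup can be tested on an interval `[0,
a]`, and finitely many such intervals have a common one. The groups `Γ` and `ℚ ⊕ Γ` then have the
common quotient `Γ ⧸ D`, with kernels `D` and `ℚ ⊕ D`. Such a situation is an
`IsOrderCorrespondence`. Tuples in the two groups match up to a bound `M` if corresponding entries
have the same image in the common quotient and if integer linear combinations with coefficients at
most `M` in absolute value have the same sign. Tuples matching up to `2 * M ^ 2` can be prolonged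
by any element of either group to tuples matching up to `M` (`TuplesMatch.exists_snoc`). Either the
new element satisfies a linear equation with small coefficients over the old ones, which is solved
in the other group thanks to the divisibility of the kernel; or it fills a cut given by finitely
many elements, and such a cut is filled in the other kernel because this is densely ordered and has
no endpoints. By induction on formulas, matching tuples satisfy the same formulas of bounded
complexity (`exists_bound_realize_iff`), and so `Γ ≡ ℚ ⊕ Γ`.

Conversely, the existence of an interval `[0, a]` with `0 < a` all of whose elements are divisible
by `p` is a first-order sentence, so that the first condition passes from any group having a
nontrivial divisible convex subgroup, such as `ℚ ⊕ Δ`, to the elementarily equivalent ones. The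
witnesses `Γ'` and `Δ` are asked for in universes unrelated to that of `Γ`. They come from the
downward Löwenheim–Skolem theorem: a countable elementary subgroup of `Γ` has a copy in every
universe.
-/

/-! ### Subgroups of a product of two groups -/

section Subgroups

variable {G : Type u} {H : Type v} [AddCommGroup G] [AddCommGroup H] {C : AddSubgroup (G × H)}
  {n : ℕ}

theorem AddSubgroup.mk_add_mem {a b : G} {c d : H} (h₁ : (a, c) ∈ C) (h₂ : (b, d) ∈ C) :
    (a + b, c + d) ∈ C := C.add_mem h₁ h₂

theorem AddSubgroup.mk_sub_mem {a b : G} {c d : H} (h₁ : (a, c) ∈ C) (h₂ : (b, d) ∈ C) :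
    (a - b, c - d) ∈ C := C.sub_mem h₁ h₂

theorem AddSubgroup.mk_zsmul_mem {a : G} {c : H} (h : (a, c) ∈ C) (m : ℤ) :
    (m • a, m • c) ∈ C := C.zsmul_mem h m

theorem AddSubgroup.mk_left_iff {a : G} {c : H} (h : (a, c) ∈ C) :
    (a, (0 : H)) ∈ C ↔ ((0 : G), c) ∈ C := by
  constructor <;> intro h'
  · simpa using AddSubgroup.mk_sub_mem h h'
  · simpa using AddSubgroup.mk_sub_mem h h'

theorem AddSubgroup.mk_sum_mem {x : Fin n → G} {y : Fin n → H} (h : ∀ i, (x i, y i) ∈ C)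
    (q : Fin n → ℤ) : (∑ i, q i • x i, ∑ i, q i • y i) ∈ C := by
  have := C.sum_mem (t := Finset.univ) (f := fun i => (q i • x i, q i • y i))
    fun i _ => AddSubgroup.mk_zsmul_mem (h i) (q i)
  rwa [prod_mk_sum]

/-- The correspondence obtained by exchanging the two groups. -/
def AddSubgroup.swapProd (C : AddSubgroup (G × H)) : AddSubgroup (H × G) :=
  C.comap (AddEquiv.prodComm : H × G ≃+ G × H).toAddMonoidHom

theorem AddSubgroup.mem_swapProd {g : G} {h : H} : (h, g) ∈ C.swapProd ↔ (g, h) ∈ C := Iff.rfl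

end Subgroups

/-! ### Correspondences between ordered groups -/

/-- A subgroup `C` of `G × H` that identifies a quotient of `G` by a nontrivial convex subgroup
`{g | (g, 0) ∈ C}` with a quotient of `H` by a nontrivial convex subgroup `{h | (0, h) ∈ C}`,
compatibly with the orders, both subgroups being `m`-divisible for all positive `m ≤ N`. -/
structure IsOrderCorrespondence {G : Type u} {H : Type v} [AddCommGroup G] [LinearOrder G]
    [AddCommGroup H] [LinearOrder H] (N : ℕ) (C : AddSubgroup (G × H)) : Prop where
  left_total : ∀ g : G, ∃ h : H, (g, h) ∈ C
  right_total : ∀ h : H, ∃ g : G, (g, h) ∈ C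
  pos_iff : ∀ g h, (g, h) ∈ C → (g, (0 : H)) ∉ C → (0 < g ↔ 0 < h)
  left_div : ∀ m : ℕ, 0 < m → m ≤ N → ∀ g, (g, (0 : H)) ∈ C → ∃ g', (g', (0 : H)) ∈ C ∧ m • g' = g
  right_div : ∀ m : ℕ, 0 < m → m ≤ N → ∀ h, ((0 : G), h) ∈ C → ∃ h', ((0 : G), h') ∈ C ∧ m • h' = h
  left_pos : ∃ g, 0 < g ∧ (g, (0 : H)) ∈ C
  right_pos : ∃ h, 0 < h ∧ ((0 : G), h) ∈ C

/-- The tuples `x` and `y` match up to `N`: corresponding entries are related by `C`, and integer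
linear combinations with coefficients of absolute value at most `N` have the same signs. -/
def TuplesMatch {G : Type u} {H : Type v} [AddCommGroup G] [LinearOrder G]
    [AddCommGroup H] [LinearOrder H] (C : AddSubgroup (G × H)) (N : ℕ) {n : ℕ}
    (x : Fin n → G) (y : Fin n → H) : Prop :=
  (∀ i, (x i, y i) ∈ C) ∧
    ∀ q : Fin n → ℤ, (∀ i, |q i| ≤ N) → (0 ≤ ∑ i, q i • x i ↔ 0 ≤ ∑ i, q i • y i)

section Correspondence

variable {G : Type u} {H : Type v} [AddCommGroup G] [LinearOrder G]
  [AddCommGroup H] [LinearOrder H] {C : AddSubgroup (G × H)} {N M n : ℕ}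

theorem IsOrderCorrespondence.symm (hC : IsOrderCorrespondence N C) :
    IsOrderCorrespondence N C.swapProd where
  left_total := hC.right_total
  right_total := hC.left_total
  pos_iff h g hgh h0 := (hC.pos_iff g h hgh fun h' =>
    h0 ((AddSubgroup.mk_left_iff (AddSubgroup.mem_swapProd.1 hgh)).1 h')).symm
  left_div := hC.right_div
  right_div := hC.left_div
  left_pos := hC.right_pos
  right_pos := hC.left_pos

theorem IsOrderCorrespondence.mono (hC : IsOrderCorrespondence N C) (h : M ≤ N) :
    IsOrderCorrespondence M C :=
  { hC with
    left_div := fun m h0 hm => hC.left_div m h0 (hm.trans h)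
    right_div := fun m h0 hm => hC.right_div m h0 (hm.trans h) }

theorem TuplesMatch.symm {x : Fin n → G} {y : Fin n → H} (h : TuplesMatch C N x y) :
    TuplesMatch C.swapProd N y x :=
  ⟨h.1, fun q hq => (h.2 q hq).symm⟩

theorem TuplesMatch.mono {x : Fin n → G} {y : Fin n → H} (h : TuplesMatch C N x y) (hM : M ≤ N) :
    TuplesMatch C M x y :=
  ⟨h.1, fun q hq => h.2 q fun i => (hq i).trans (by exact_mod_cast hM)⟩

variable [IsOrderedAddMonoid H]

/-- Finitely many elements of the kernel of `H` can be separated by one in the kernel. -/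
theorem IsOrderCorrespondence.exists_between (hC : IsOrderCorrespondence N C) (hN : 2 ≤ N)
    {ι : Type*} [Finite ι] (L U : ι → Prop) (e : ι → H) (he : ∀ i, ((0 : G), e i) ∈ C)
    (hLU : ∀ i j, L i → U j → e i < e j) :
    ∃ z, ((0 : G), z) ∈ C ∧ (∀ i, L i → e i < z) ∧ ∀ j, U j → z < e j := by
  classical
  cases nonempty_fintype ι
  let E : AddSubgroup H := C.comap (AddMonoidHom.inr G H)
  have : Nontrivial E := by
    obtain ⟨h, h0, hh⟩ := hC.right_pos
    exact ⟨⟨⟨h, hh⟩, 0, fun h' => h0.ne' (congrArg Subtype.val h')⟩⟩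
  have : DenselyOrdered E := ⟨fun a b hab => by
    obtain ⟨c, hc, hcc⟩ := hC.right_div 2 two_pos hN (b.1 - a.1) (b - a).2
    have hc0 : 0 < c := by
      have : 0 < 2 • c := by rw [hcc]; exact sub_pos.2 hab
      exact (nsmul_pos_iff two_ne_zero).1 this
    refine ⟨a + ⟨c, hc⟩, ?_, ?_⟩
    · exact lt_add_of_pos_right a.1 hc0
    · change a.1 + c < b.1
      have : b.1 = a.1 + (c + c) := by rw [← two_nsmul, hcc]; abel
      rw [this]
      gcongr
      exact lt_add_of_pos_right c hc0⟩
  let e' : ι → E := fun i => ⟨e i, he i⟩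
  obtain ⟨z, hz₁, hz₂⟩ := Order.exists_between_finsets
    ((Finset.univ.filter L).image e') ((Finset.univ.filter U).image e') (by
      simp only [Finset.mem_image, Finset.mem_filter, Finset.mem_univ, true_and]
      rintro _ ⟨i, hi, rfl⟩ _ ⟨j, hj, rfl⟩
      exact hLU i j hi hj)
  refine ⟨z.1, z.2, fun i hi => hz₁ (e' i) ?_, fun j hj => hz₂ (e' j) ?_⟩
  · exact Finset.mem_image_of_mem _ (by simpa using hi)
  · exact Finset.mem_image_of_mem _ (by simpa using hj)

variable [IsOrderedAddMonoid G]

theorem TuplesMatch.pos_iff {x : Fin n → G} {y : Fin n → H} (h : TuplesMatch C N x y)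
    (q : Fin n → ℤ) (hq : ∀ i, |q i| ≤ N) : 0 < ∑ i, q i • x i ↔ 0 < ∑ i, q i • y i := by
  have := h.2 (fun i => - q i) (by simpa using hq)
  simp only [neg_smul, Finset.sum_neg_distrib, Left.nonneg_neg_iff] at this
  rw [← not_le, this, not_le]

/-- Matching tuples satisfy the same linear inequalities. -/
theorem TuplesMatch.sum_lt_sum_iff {x : Fin n → G} {y : Fin n → H} (h : TuplesMatch C N x y)
    (p q : Fin n → ℤ) (hq : ∀ i, |q i - p i| ≤ N) :
    ∑ i, p i • x i < ∑ i, q i • x i ↔ ∑ i, p i • y i < ∑ i, q i • y i := by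
  have := h.pos_iff (fun i => q i - p i) hq
  simpa only [sub_smul, Finset.sum_sub_distrib, sub_pos] using this

/-- Order relations between two related pairs whose difference does not lie in the kernel. -/
theorem IsOrderCorrespondence.lt_iff (hC : IsOrderCorrespondence N C) {a b : G} {c d : H}
    (h₁ : (a, c) ∈ C) (h₂ : (b, d) ∈ C) (h : ((0 : G), d - c) ∉ C) : a < b ↔ c < d := by
  have h₃ := AddSubgroup.mk_sub_mem h₂ h₁
  rw [← sub_pos, hC.pos_iff _ _ h₃ fun h' => h ((AddSubgroup.mk_left_iff h₃).1 h'), sub_pos]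

/-- A finite system of linear conditions `m i * X ⋚ a i` on one unknown that is realized by `x'` in
`G` is realized by some related element in `H`, provided that the positions of the bounds
`a i / m i` relative to each other are the same in both groups. -/
theorem IsOrderCorrespondence.exists_same_cut (hC : IsOrderCorrespondence N C) (hN : 2 ≤ N)
    {ι : Type*} [Finite ι] (m : ι → ℕ) (hm0 : ∀ i, 0 < m i) (hm : ∀ i, m i ≤ N)
    (a : ι → G) (b : ι → H) (hab : ∀ i, (a i, b i) ∈ C)
    (hcut : ∀ i j, m i • a j < m j • a i ↔ m i • b j < m j • b i) (x' : G) :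
    ∃ y', (x', y') ∈ C ∧ (∀ i, a i < m i • x' ↔ b i < m i • y') ∧
      ∀ i, m i • x' < a i ↔ m i • y' < b i := by
  classical
  obtain ⟨h₀, hh₀⟩ := hC.left_total x'
  have hmh : ∀ i y, (x', y) ∈ C → (m i • x', m i • y) ∈ C := fun i y hy => C.nsmul_mem hy (m i)
  have hker : ∀ y z, (x', y) ∈ C → ((0 : G), z) ∈ C → (x', y + z) ∈ C := fun y z h₁ h₂ => by
    simpa using AddSubgroup.mk_add_mem h₁ h₂
  by_cases hex : ∃ s, m s • x' = a s
  · -- The element `x'` is itself a bound, hence determines `y'` by division.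
    obtain ⟨s, hs⟩ := hex
    have hd : ((0 : G), b s - m s • h₀) ∈ C := by
      simpa [hs] using AddSubgroup.mk_sub_mem (hab s) (hmh s _ hh₀)
    obtain ⟨e, he, hme⟩ := hC.right_div (m s) (hm0 s) (hm s) _ hd
    have hy : m s • (h₀ + e) = b s := by rw [nsmul_add, hme]; abel
    refine ⟨h₀ + e, hker _ _ hh₀ he, fun t => ?_, fun t => ?_⟩
    · rw [← smul_lt_smul_iff_of_pos_left (hm0 s), ← smul_lt_smul_iff_of_pos_left (β := H) (hm0 s),
        smul_comm (m s) (m t) x', hs, smul_comm (m s) (m t) (h₀ + e), hy, hcut]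
    · rw [← smul_lt_smul_iff_of_pos_left (hm0 s), ← smul_lt_smul_iff_of_pos_left (β := H) (hm0 s),
        smul_comm (m s) (m t) x', hs, smul_comm (m s) (m t) (h₀ + e), hy, hcut]
  · push Not at hex
    -- Only the bounds with `b i` in the coset of `m i • h₀` matter, the others being decided by the
    -- common quotient. For those, `e i` stands for `b i / m i - h₀`; elsewhere it is a dummy.
    have hdiv : ∀ i, ∃ e, ((0 : G), e) ∈ C ∧
        (((0 : G), b i - m i • h₀) ∈ C → m i • e = b i - m i • h₀) := fun i => by
      by_cases h : ((0 : G), b i - m i • h₀) ∈ C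
      · obtain ⟨e, he, hme⟩ := hC.right_div (m i) (hm0 i) (hm i) _ h
        exact ⟨e, he, fun _ => hme⟩
      · exact ⟨0, C.zero_mem, fun h' => absurd h' h⟩
    choose e he hme using hdiv
    have hb : ∀ i, ((0 : G), b i - m i • h₀) ∈ C → b i = m i • (h₀ + e i) := fun i hi => by
      rw [nsmul_add, hme i hi]; abel
    obtain ⟨z, hz, hzL, hzU⟩ := hC.exists_between hN
      (fun i => ((0 : G), b i - m i • h₀) ∈ C ∧ a i < m i • x')
      (fun i => ((0 : G), b i - m i • h₀) ∈ C ∧ m i • x' < a i) e he (by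
        rintro i j ⟨hi, hi'⟩ ⟨hj, hj'⟩
        have h₁ : m j • a i < m i • a j :=
          calc m j • a i < m j • m i • x' := (smul_lt_smul_iff_of_pos_left (hm0 j)).2 hi'
            _ = m i • m j • x' := smul_comm _ _ _
            _ < m i • a j := (smul_lt_smul_iff_of_pos_left (hm0 i)).2 hj'
        rw [hcut, hb i hi, hb j hj, smul_comm (m i) (m j),
          smul_lt_smul_iff_of_pos_left (hm0 j), smul_lt_smul_iff_of_pos_left (hm0 i)] at h₁
        exact lt_of_add_lt_add_left h₁)
    have hy := hker _ _ hh₀ hz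
    have key : ∀ i, (a i < m i • x' → b i < m i • (h₀ + z)) ∧
        (m i • x' < a i → m i • (h₀ + z) < b i) := fun i => by
      by_cases hi : ((0 : G), b i - m i • h₀) ∈ C
      · refine ⟨fun h => ?_, fun h => ?_⟩
        · rw [hb i hi, smul_lt_smul_iff_of_pos_left (hm0 i)]
          exact add_lt_add_right (hzL i ⟨hi, h⟩) _
        · rw [hb i hi, smul_lt_smul_iff_of_pos_left (hm0 i)]
          exact add_lt_add_right (hzU i ⟨hi, h⟩) _
      · have hz' : ((0 : G), m i • z) ∈ C := by simpa using C.nsmul_mem hz (m i)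
        have hi₁ : ((0 : G), b i - m i • (h₀ + z)) ∉ C := fun h => hi <| by
          have := AddSubgroup.mk_add_mem h hz'
          rw [nsmul_add] at this
          convert this using 2 <;> abel
        have hi₂ : ((0 : G), m i • (h₀ + z) - b i) ∉ C := fun h => hi₁ <| by
          simpa using C.neg_mem h
        exact ⟨(hC.lt_iff (hab i) (hmh i _ hy) hi₂).1, (hC.lt_iff (hmh i _ hy) (hab i) hi₁).1⟩
    refine ⟨h₀ + z, hy, fun i => ⟨(key i).1, fun h => ?_⟩, fun i => ⟨(key i).2, fun h => ?_⟩⟩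
    · exact (lt_or_gt_of_ne (hex i)).resolve_left fun h' => h.not_gt ((key i).2 h')
    · exact (lt_or_gt_of_ne (hex i)).resolve_right fun h' => h.not_gt ((key i).1 h')

/-- The "forth" step: the bound `2 * N ^ 2` suffices since comparing `p / m` and `q / k` for
coefficients bounded by `N` amounts to finding the sign of `k * p - m * q`. -/
theorem TuplesMatch.exists_snoc {x : Fin n → G} {y : Fin n → H}
    (hC : IsOrderCorrespondence N C) (hN : 2 ≤ N) (h : TuplesMatch C (2 * N ^ 2) x y) (x' : G) :
    ∃ y', TuplesMatch C N (Fin.snoc x x' : Fin (n + 1) → G) (Fin.snoc y y' : Fin (n + 1) → H) := by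
  let ι := (Fin n → Finset.Icc (-(N : ℤ)) N) × Finset.Icc 1 N
  have hq : ∀ (i : ι) k, |((i.1 k : ℤ))| ≤ N := fun i k => abs_le.2 (Finset.mem_Icc.1 (i.1 k).2)
  have hm0 : ∀ i : ι, 0 < (i.2 : ℕ) := fun i => (Finset.mem_Icc.1 i.2.2).1
  have hm : ∀ i : ι, (i.2 : ℕ) ≤ N := fun i => (Finset.mem_Icc.1 i.2.2).2
  obtain ⟨y', hy', h₁, h₂⟩ := hC.exists_same_cut hN (ι := ι) (fun i => i.2) hm0 hm
    (fun i => ∑ k, (i.1 k : ℤ) • x k) (fun i => ∑ k, (i.1 k : ℤ) • y k)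
    (fun i => AddSubgroup.mk_sum_mem h.1 _) (fun i j => by
      simp only [Finset.smul_sum, ← natCast_zsmul, smul_smul]
      refine h.sum_lt_sum_iff _ _ fun k => ?_
      have b₁ : |((j.2 : ℕ) : ℤ) * (i.1 k : ℤ)| ≤ N * N := by
        rw [abs_mul, Nat.abs_cast]
        exact mul_le_mul (by exact_mod_cast hm j) (hq i k) (abs_nonneg _) (by positivity)
      have b₂ : |((i.2 : ℕ) : ℤ) * (j.1 k : ℤ)| ≤ N * N := by
        rw [abs_mul, Nat.abs_cast]
        exact mul_le_mul (by exact_mod_cast hm i) (hq j k) (abs_nonneg _) (by positivity)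
      have := abs_sub (((j.2 : ℕ) : ℤ) * (i.1 k : ℤ)) (((i.2 : ℕ) : ℤ) * (j.1 k : ℤ))
      push_cast
      linarith) x'
  refine ⟨y', Fin.lastCases (by simpa using hy') (by simpa using h.1), fun q hqN => ?_⟩
  simp only [Fin.sum_univ_castSucc, Fin.snoc_castSucc, Fin.snoc_last]
  have hqc := fun i => abs_le.1 (hqN i)
  obtain h0 | h0 | h0 := lt_trichotomy (q (Fin.last n)) 0
  · have hmem : (-q (Fin.last n)).toNat ∈ Finset.Icc 1 N := by
      have := hqc (Fin.last n)
      rw [Finset.mem_Icc]; omega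
    have := h₁ (fun k => ⟨q k.castSucc, Finset.mem_Icc.2 (hqc _)⟩, ⟨_, hmem⟩)
    have hc : (((-q (Fin.last n)).toNat : ℕ) : ℤ) = -q (Fin.last n) := Int.toNat_of_nonneg (by omega)
    simp only [← natCast_zsmul, hc, neg_smul] at this
    rw [← neg_le_iff_add_nonneg, ← neg_le_iff_add_nonneg, neg_le, neg_le, ← not_lt, this, not_lt]
  · have hN2 : N ≤ 2 * N ^ 2 := by nlinarith
    simpa [h0] using (h.mono hN2).2 (fun k => q k.castSucc) (fun k => hqN _)
  · have hmem : (q (Fin.last n)).toNat ∈ Finset.Icc 1 N := by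
      have := hqc (Fin.last n)
      rw [Finset.mem_Icc]; omega
    have := h₂ (fun k => ⟨-q k.castSucc, Finset.mem_Icc.2 (by
      have := hqc k.castSucc; constructor <;> omega)⟩, ⟨_, hmem⟩)
    have hc : (((q (Fin.last n)).toNat : ℕ) : ℤ) = q (Fin.last n) := Int.toNat_of_nonneg (by omega)
    simp only [← natCast_zsmul, hc, neg_smul, Finset.sum_neg_distrib] at this
    rw [← neg_le_iff_add_nonneg', ← neg_le_iff_add_nonneg', ← not_lt, this, not_lt]

end Correspondence

/-! ### First-order formulas and correspondences -/

section Formulas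

open FirstOrder FirstOrder.Language

/-- The coefficients of the linear form that a term defines, obtained by evaluating the term in
`ℤⁿ` at the standard basis. -/
def termCoeff {n : ℕ} (t : orderedGroupLang.Term (Empty ⊕ Fin n)) : Fin n → ℤ :=
  t.realize (Sum.elim Empty.elim fun i => Pi.single i 1)

theorem realize_eq_sum_termCoeff {G : Type u} [AddCommGroup G] [LE G] {n : ℕ}
    (t : orderedGroupLang.Term (Empty ⊕ Fin n)) (v : Empty → G) (x : Fin n → G) :
    t.realize (Sum.elim v x) = ∑ i, termCoeff t i • x i := by
  induction t with
  | var a =>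
    rcases a with e | i
    · exact e.elim
    · simp [termCoeff, Term.realize, Pi.single_apply]
  | func f ts ih =>
    cases f with
    | zero =>
      have : termCoeff (Term.func OrderedGroupFunc.zero ts : orderedGroupLang.Term _) = 0 := rfl
      rw [this]
      simp only [Pi.zero_apply, zero_smul, Finset.sum_const_zero]
      rfl
    | neg =>
      have : termCoeff (Term.func OrderedGroupFunc.neg ts : orderedGroupLang.Term _) =
        -termCoeff (ts 0) := rfl
      rw [this]
      simp only [Pi.neg_apply, neg_smul, Finset.sum_neg_distrib, ← ih]
      rfl
    | add =>
      have : termCoeff (Term.func OrderedGroupFunc.add ts : orderedGroupLang.Term _) =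
        termCoeff (ts 0) + termCoeff (ts 1) := rfl
      rw [this]
      simp only [Pi.add_apply, add_smul, Finset.sum_add_distrib, ← ih]
      rfl

theorem exists_abs_le {n : ℕ} (q : Fin n → ℤ) : ∃ N : ℕ, ∀ i, |q i| ≤ N :=
  ⟨∑ i, (q i).natAbs, fun i => by
    rw [Int.abs_eq_natAbs]
    exact_mod_cast Finset.single_le_sum (f := fun i => (q i).natAbs)
      (fun _ _ => Nat.zero_le _) (Finset.mem_univ i)⟩

variable (G : Type u) (H : Type v) [AddCommGroup G] [LinearOrder G] [IsOrderedAddMonoid G]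
  [AddCommGroup H] [LinearOrder H] [IsOrderedAddMonoid H]

/-- A formula cannot distinguish matching tuples, once the coefficient bound is large in terms of
the formula. -/
theorem exists_bound_realize_iff {n : ℕ} (φ : orderedGroupLang.BoundedFormula Empty n) :
    ∃ N : ℕ, ∀ C : AddSubgroup (G × H), IsOrderCorrespondence N C →
      ∀ (x : Fin n → G) (y : Fin n → H), TuplesMatch C N x y →
        ∀ (v : Empty → G) (w : Empty → H), φ.Realize v x ↔ φ.Realize w y := by
  induction φ with
  | falsum => exact ⟨0, fun _ _ _ _ _ _ _ => Iff.rfl⟩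
  | equal t₁ t₂ =>
    obtain ⟨N, hN⟩ := exists_abs_le (fun i => termCoeff t₂ i - termCoeff t₁ i)
    refine ⟨N, fun C _ x y h v w => ?_⟩
    have h₁ := h.sum_lt_sum_iff _ _ hN
    have h₂ := h.sum_lt_sum_iff (termCoeff t₂) (termCoeff t₁) fun i => by
      rw [abs_sub_comm]; exact hN i
    change t₁.realize _ = t₂.realize _ ↔ t₁.realize _ = t₂.realize _
    simp only [realize_eq_sum_termCoeff]
    rw [eq_iff_le_not_lt, eq_iff_le_not_lt, ← not_lt, ← not_lt, h₁, h₂]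
  | rel R ts =>
    cases R with
    | le =>
      obtain ⟨N, hN⟩ := exists_abs_le (fun i => termCoeff (ts 0) i - termCoeff (ts 1) i)
      refine ⟨N, fun C _ x y h v w => ?_⟩
      change (ts 0).realize _ ≤ (ts 1).realize _ ↔ (ts 0).realize _ ≤ (ts 1).realize _
      simp only [realize_eq_sum_termCoeff]
      rw [← not_lt, ← not_lt, h.sum_lt_sum_iff _ _ hN]
  | imp f₁ f₂ ih₁ ih₂ =>
    obtain ⟨N₁, h₁⟩ := ih₁
    obtain ⟨N₂, h₂⟩ := ih₂
    refine ⟨max N₁ N₂, fun C hC x y h v w => ?_⟩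
    have i₁ := h₁ C (hC.mono (le_max_left _ _)) x y (h.mono (le_max_left _ _)) v w
    have i₂ := h₂ C (hC.mono (le_max_right _ _)) x y (h.mono (le_max_right _ _)) v w
    simp only [BoundedFormula.realize_imp, i₁, i₂]
  | all f ih =>
    obtain ⟨M, hM⟩ := ih
    let N := max M 2
    have hN : 2 ≤ N := le_max_right _ _
    have hNN : N ≤ 2 * N ^ 2 := by nlinarith
    refine ⟨2 * N ^ 2, fun C hC x y h v w => ?_⟩
    have hCN := hC.mono hNN
    simp only [BoundedFormula.realize_all]
    refine ⟨fun hf y' => ?_, fun hf x' => ?_⟩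
    · obtain ⟨x', hx'⟩ := h.symm.exists_snoc hCN.symm hN y'
      exact (hM C (hCN.mono (le_max_left _ _)) _ _ (hx'.symm.mono (le_max_left _ _)) v w).1 (hf x')
    · obtain ⟨y', hy'⟩ := h.exists_snoc hCN hN x'
      exact (hM C (hCN.mono (le_max_left _ _)) _ _ (hy'.mono (le_max_left _ _)) v w).2 (hf y')

variable {G H} in
/-- Groups with correspondences whose kernels are as divisible as desired are elementarily
equivalent. -/
theorem elementarilyEquivalent_of_correspondences
    (h : ∀ N : ℕ, ∃ C : AddSubgroup (G × H), IsOrderCorrespondence N C) :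
    G ≅[orderedGroupLang] H := by
  rw [elementarilyEquivalent_iff]
  intro φ
  obtain ⟨N, hN⟩ := exists_bound_realize_iff G H φ
  obtain ⟨C, hC⟩ := h N
  exact hN C hC _ _ ⟨fun i => i.elim0, fun q _ => by simp⟩ _ _

end Formulas

/-! ### Divisible convex subgroups -/

section Convex

variable {G : Type u} [AddCommGroup G] [LinearOrder G] [IsOrderedAddMonoid G]

/-- Some nontrivial initial segment `[0, a]` consists of elements divisible by `n`. This is a
first-order condition on the group. -/
def HasNDivisibleSegment (n : ℕ) (G : Type u) [AddCommGroup G] [LinearOrder G] : Prop :=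
  ∃ a : G, 0 < a ∧ ∀ x, 0 ≤ x → x ≤ a → ∃ y, n • y = x

/-- The convex subgroup generated by an element, which is meant to be nonnegative. -/
def AddSubgroup.convexHullSingleton (a : G) : AddSubgroup G where
  carrier := {x | ∃ k : ℕ, |x| ≤ k • a}
  zero_mem' := ⟨0, by simp⟩
  neg_mem' := by simp
  add_mem' := by
    rintro x y ⟨k, hk⟩ ⟨l, hl⟩
    exact ⟨k + l, (abs_add_le x y).trans (by rw [add_smul]; exact add_le_add hk hl)⟩

theorem AddSubgroup.ordConnected_of_abs_le {D : AddSubgroup G}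
    (h : ∀ x ∈ D, ∀ y, |y| ≤ |x| → y ∈ D) : (D : Set G).OrdConnected := by
  refine ⟨fun x hx y hy z hz => ?_⟩
  obtain hz' | hz' := le_total 0 z
  · exact h y hy z (abs_le_abs_of_nonneg hz' hz.2)
  · refine h x hx z ?_
    rw [abs_of_nonpos hz', abs_of_nonpos (hz.1.trans hz')]
    exact neg_le_neg hz.1

theorem AddSubgroup.mem_of_abs_le {D : AddSubgroup G} (hD : (D : Set G).OrdConnected) {x y : G}
    (hx : x ∈ D) (h : |y| ≤ |x|) : y ∈ D := by
  have hx' : |x| ∈ D := by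
    obtain h' | h' := abs_choice x <;> rw [h']
    exacts [hx, D.neg_mem hx]
  exact hD.out (D.neg_mem hx') hx' (abs_le.1 h)

/-- Every element of the convex subgroup generated by `a` is, up to sign, a sum of copies of `a`
and an element of `[0, a]`. -/
theorem HasNDivisibleSegment.hasNDivisibleConvexSubgroup {n : ℕ} (hn : 0 < n)
    (h : HasNDivisibleSegment n G) : HasNDivisibleConvexSubgroup n G := by
  obtain ⟨a, ha, hdiv⟩ := h
  have hmul : ∀ k : ℕ, ∀ x, 0 ≤ x → x ≤ k • a → ∃ y, n • y = x := by
    intro k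
    induction k with
    | zero =>
      intro x h₀ h₁
      exact ⟨0, by rw [smul_zero]; exact le_antisymm h₀ (by simpa using h₁)⟩
    | succ k ih =>
      intro x h₀ h₁
      obtain hxa | hxa := le_total x a
      · exact hdiv x h₀ hxa
      · obtain ⟨y, hy⟩ := ih (x - a) (sub_nonneg.2 hxa) (by
          rw [sub_le_iff_le_add, ← succ_nsmul]; exact h₁)
        obtain ⟨z, hz⟩ := hdiv a ha.le le_rfl
        exact ⟨y + z, by rw [smul_add, hy, hz, sub_add_cancel]⟩
  refine ⟨AddSubgroup.convexHullSingleton a, ?_, ?_, ?_⟩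
  · intro hbot
    have : a ∈ AddSubgroup.convexHullSingleton a := ⟨1, by rw [one_smul, abs_of_pos ha]⟩
    rw [hbot, AddSubgroup.mem_bot] at this
    exact ha.ne' this
  · exact AddSubgroup.ordConnected_of_abs_le fun x ⟨k, hk⟩ y hy => ⟨k, hy.trans hk⟩
  · rintro ⟨x, k, hk⟩
    obtain ⟨y, hy⟩ : ∃ y, n • y = x := by
      obtain hx | hx := le_total 0 x
      · exact hmul k x hx (by rwa [abs_of_nonneg hx] at hk)
      · obtain ⟨y, hy⟩ := hmul k (-x) (by simpa using hx) (by rwa [abs_of_nonpos hx] at hk)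
        exact ⟨-y, by rw [smul_neg, hy, neg_neg]⟩
    refine ⟨⟨y, k, le_trans ?_ hk⟩, Subtype.ext hy⟩
    rw [← hy, abs_nsmul]
    exact le_self_nsmul (abs_nonneg y) hn.ne'

theorem HasNDivisibleConvexSubgroup.hasNDivisibleSegment {n : ℕ}
    (h : HasNDivisibleConvexSubgroup n G) : HasNDivisibleSegment n G := by
  obtain ⟨D, hD, hconv, hdiv⟩ := h
  obtain ⟨a, ha⟩ := AddSubgroup.ne_bot_iff_exists_ne_zero.1 hD
  refine ⟨|a.1|, abs_pos.2 fun h => ha (Subtype.ext h), fun x h₀ h₁ => ?_⟩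
  obtain ⟨y, hy⟩ := hdiv ⟨x, AddSubgroup.mem_of_abs_le hconv a.2 (by rwa [abs_of_nonneg h₀])⟩
  exact ⟨y, congrArg Subtype.val hy⟩

theorem HasNDivisibleSegment.mul {m n : ℕ} (hm : HasNDivisibleSegment m G) (hm0 : 0 < m)
    (hn : HasNDivisibleSegment n G) : HasNDivisibleSegment (m * n) G := by
  obtain ⟨a, ha, ha'⟩ := hm
  obtain ⟨b, hb, hb'⟩ := hn
  refine ⟨min a b, lt_min ha hb, fun x h₀ h₁ => ?_⟩
  obtain ⟨y, rfl⟩ := ha' x h₀ (h₁.trans (min_le_left _ _))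
  have hy0 : 0 ≤ y := (nsmul_nonneg_iff hm0.ne').1 h₀
  obtain ⟨z, rfl⟩ := hb' y hy0 ((le_self_nsmul hy0 hm0.ne').trans (h₁.trans (min_le_right _ _)))
  exact ⟨z, mul_smul _ _ _⟩

theorem hasNDivisibleSegment_of_forall_prime
    (h : ∀ p : ℕ, p.Prime → HasNDivisibleSegment p G) {n : ℕ} (hn : 0 < n) :
    HasNDivisibleSegment n G := by
  induction n using induction_on_primes with
  | zero => exact absurd hn (lt_irrefl 0)
  | one =>
    obtain ⟨a, ha, -⟩ := h 2 Nat.prime_two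
    exact ⟨a, ha, fun x _ _ => ⟨x, one_smul _ _⟩⟩
  | prime_mul p k hp ih => exact (h p hp).mul hp.pos (ih (pos_of_mul_pos_right hn p.zero_le))

end Convex

/-! ### The sum `ℚ ⊕ G` -/

section RatSum

variable {G : Type u} [AddCommGroup G]

/-- A convex subgroup `D` of `G` makes `G ⧸ D` a common quotient of `G` and `ℚ ⊕ G`. -/
def ratSumCorrespondence (D : AddSubgroup G) : AddSubgroup (G × InvLexSum ℚ G) where
  carrier := {p | p.1 - (ofLex p.2).1 ∈ D}
  zero_mem' := by simp
  neg_mem' {p} hp := by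
    have := D.neg_mem hp
    simpa [sub_eq_add_neg, add_comm] using this
  add_mem' {p q} hp hq := by
    have := D.add_mem hp hq
    simpa [add_sub_add_comm] using this

theorem mem_ratSumCorrespondence {D : AddSubgroup G} {g : G} {h : InvLexSum ℚ G} :
    (g, h) ∈ ratSumCorrespondence D ↔ g - (ofLex h).1 ∈ D := Iff.rfl

theorem IsNDivisible.of_dvd {A : Type u} [AddCommGroup A] {m n : ℕ} (h : IsNDivisible n A)
    (hmn : m ∣ n) : IsNDivisible m A := fun x => by
  obtain ⟨k, rfl⟩ := hmn
  obtain ⟨y, hy⟩ := h x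
  exact ⟨k • y, by rw [← mul_smul, hy]⟩

variable [LinearOrder G]

theorem hasDivisibleConvexSubgroup_ratSum :
    HasDivisibleConvexSubgroup (InvLexSum ℚ G) := by
  let D : AddSubgroup (InvLexSum ℚ G) :=
    { carrier := {x | (ofLex x).1 = 0}
      zero_mem' := rfl
      neg_mem' := fun {x} (hx : (ofLex x).1 = 0) => by
        change -(ofLex x).1 = 0
        rw [hx, neg_zero]
      add_mem' := fun {x y} (hx : (ofLex x).1 = 0) (hy : (ofLex y).1 = 0) => by
        change (ofLex x).1 + (ofLex y).1 = 0
        rw [hx, hy, add_zero] }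
  refine ⟨D, fun hbot => ?_, ⟨fun x hx y hy z hz => ?_⟩, fun n hn x => ?_⟩
  · have : (toLex (0, 1) : InvLexSum ℚ G) ∈ D := rfl
    rw [hbot, AddSubgroup.mem_bot] at this
    exact one_ne_zero (congrArg (fun z => (ofLex z).2) this)
  · have h₁ := Prod.Lex.monotone_fst _ _ hz.1
    have h₂ := Prod.Lex.monotone_fst _ _ hz.2
    change (ofLex x).1 = 0 at hx
    change (ofLex y).1 = 0 at hy
    rw [hx] at h₁
    rw [hy] at h₂
    exact le_antisymm h₂ h₁
  · have hn' : (n : ℚ) ≠ 0 := by exact_mod_cast hn.ne'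
    refine ⟨⟨toLex (0, (ofLex x.1).2 / n), rfl⟩, Subtype.ext ?_⟩
    apply ofLex.injective
    refine Prod.ext ?_ ?_
    · change n • (0 : G) = (ofLex x.1).1
      rw [smul_zero]; exact x.2.symm
    · change n • ((ofLex x.1).2 / (n : ℚ)) = (ofLex x.1).2
      rw [nsmul_eq_mul]; field_simp

variable [IsOrderedAddMonoid G]

theorem isOrderCorrespondence_ratSum {D : AddSubgroup G} (hD : D ≠ ⊥)
    (hconv : (D : Set G).OrdConnected) {N : ℕ} (hdiv : IsNDivisible N.factorial D) :
    IsOrderCorrespondence N (ratSumCorrespondence D) where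
  left_total g := ⟨toLex (g, 0), by simp [mem_ratSumCorrespondence]⟩
  right_total h := ⟨(ofLex h).1, by simp [mem_ratSumCorrespondence]⟩
  pos_iff g h hgh hg := by
    have hg' : g ∉ D := fun hg' => hg (by simpa [mem_ratSumCorrespondence] using hg')
    rw [mem_ratSumCorrespondence] at hgh
    obtain ⟨⟨k, q⟩, rfl⟩ := toLex.surjective h
    change g - k ∈ D at hgh
    have hk : k ∉ D := fun hk => hg' (by simpa using D.add_mem hgh hk)
    have hk0 : 0 ≠ k := fun hk0 => hk (hk0 ▸ D.zero_mem)
    have hq : 0 < toLex (k, q) ↔ 0 < k := by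
      rw [Prod.Lex.lt_iff]
      simp [hk0]
    rw [hq]
    constructor
    · intro h0
      by_contra hk'
      refine hg' (AddSubgroup.mem_of_abs_le hconv hgh ?_)
      have : g ≤ g - k := by simpa using hk'
      rwa [abs_of_pos h0, abs_of_pos (h0.trans_le this)]
    · intro h0
      by_contra hg0
      refine hk (AddSubgroup.mem_of_abs_le hconv hgh ?_)
      have h1 : g - k ≤ -k := by simpa using hg0
      rw [abs_of_pos h0, abs_of_neg (h1.trans_lt (by simpa using h0))]
      exact le_neg_of_le_neg h1
  left_div m h0 hm g hg := by
    have hg' : g ∈ D := by simpa [mem_ratSumCorrespondence] using hg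
    obtain ⟨y, hy⟩ := hdiv.of_dvd (Nat.dvd_factorial h0 hm) ⟨g, hg'⟩
    exact ⟨y, by simp [mem_ratSumCorrespondence], congrArg Subtype.val hy⟩
  right_div m h0 hm h hh := by
    obtain ⟨⟨k, q⟩, rfl⟩ := toLex.surjective h
    have hk : k ∈ D := by simpa [mem_ratSumCorrespondence] using hh
    obtain ⟨y, hy⟩ := hdiv.of_dvd (Nat.dvd_factorial h0 hm) ⟨k, hk⟩
    refine ⟨toLex (y.1, q / m), by simp [mem_ratSumCorrespondence], ?_⟩
    have hm' : (m : ℚ) ≠ 0 := by exact_mod_cast h0.ne'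
    refine ofLex.injective (Prod.ext (congrArg Subtype.val hy) ?_)
    change m • (q / m) = q
    rw [nsmul_eq_mul]; field_simp
  left_pos := by
    obtain ⟨a, ha⟩ := AddSubgroup.ne_bot_iff_exists_ne_zero.1 hD
    refine ⟨|a.1|, abs_pos.2 fun h => ha (Subtype.ext h), ?_⟩
    simp [mem_ratSumCorrespondence, AddSubgroup.mem_of_abs_le hconv a.2 (abs_abs a.1).le]
  right_pos := ⟨toLex (0, 1), by rw [Prod.Lex.lt_iff]; simp, by simp [mem_ratSumCorrespondence]⟩

theorem elementarilyEquivalent_ratSum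
    (h : ∀ p : ℕ, p.Prime → HasNDivisibleConvexSubgroup p G) :
    G ≅[orderedGroupLang] InvLexSum ℚ G := by
  refine elementarilyEquivalent_of_correspondences fun N => ?_
  have hN := N.factorial_pos
  obtain ⟨D, hD, hconv, hdiv⟩ := (hasNDivisibleSegment_of_forall_prime
    (fun p hp => (h p hp).hasNDivisibleSegment) hN).hasNDivisibleConvexSubgroup hN
  exact ⟨_, isOrderCorrespondence_ratSum hD hconv hdiv⟩

end RatSum

/-! ### Elementary properties and countable models -/

section Elementary

open FirstOrder FirstOrder.Language

/-- The term `n • t`. -/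
def nsmulTerm {α : Type*} (t : orderedGroupLang.Term α) : ℕ → orderedGroupLang.Term α
  | 0 => Constants.term (OrderedGroupFunc.zero : orderedGroupLang.Constants)
  | n + 1 => Functions.apply₂ (OrderedGroupFunc.add : orderedGroupLang.Functions 2)
      (nsmulTerm t n) t

theorem realize_nsmulTerm {α : Type*} {G : Type u} [AddCommGroup G] [LE G]
    (t : orderedGroupLang.Term α) (v : α → G) (n : ℕ) :
    (nsmulTerm t n).realize v = n • t.realize v := by
  induction n with
  | zero => rw [zero_smul]; rfl
  | succ n ih => rw [succ_nsmul, ← ih]; rfl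

/-- The atomic formula `s ≤ t`. -/
def leFormula {α : Type*} {n : ℕ} (s t : orderedGroupLang.Term (α ⊕ Fin n)) :
    orderedGroupLang.BoundedFormula α n :=
  Relations.boundedFormula₂ (OrderedGroupRel.le : orderedGroupLang.Relations 2) s t

theorem realize_leFormula {α : Type*} {n : ℕ} {G : Type u} [AddCommGroup G] [LE G]
    (s t : orderedGroupLang.Term (α ⊕ Fin n)) (v : α → G) (x : Fin n → G) :
    (leFormula s t).Realize v x ↔ s.realize (Sum.elim v x) ≤ t.realize (Sum.elim v x) :=
  Iff.rfl

/-- The sentence `∃ a, ¬ a ≤ 0 ∧ ∀ x, 0 ≤ x ∧ x ≤ a → ∃ y, n • y = x`. -/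
def divisibleSegmentSentence (n : ℕ) : orderedGroupLang.Sentence :=
  ∃' (∼(leFormula (&0) (nsmulTerm (&0) 0)) ⊓
    ∀' ((leFormula (nsmulTerm (&0) 0) (&1) ⊓ leFormula (&1) (&0)) ⟹
      ∃' ((nsmulTerm (&2) n) =' (&1))))

theorem realize_divisibleSegmentSentence (n : ℕ) (G : Type u) [AddCommGroup G] [LinearOrder G] :
    G ⊨ divisibleSegmentSentence n ↔ HasNDivisibleSegment n G := by
  simp only [divisibleSegmentSentence, HasNDivisibleSegment, Sentence.Realize, Formula.Realize,
    BoundedFormula.realize_ex, BoundedFormula.realize_inf, BoundedFormula.realize_not,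
    BoundedFormula.realize_all, BoundedFormula.realize_imp, BoundedFormula.realize_bdEqual,
    realize_leFormula, realize_nsmulTerm, zero_smul, not_le, and_imp]
  rfl

theorem hasNDivisibleConvexSubgroup_iff_of_elementarilyEquivalent {G : Type u} {H : Type v}
    [AddCommGroup G] [LinearOrder G] [IsOrderedAddMonoid G]
    [AddCommGroup H] [LinearOrder H] [IsOrderedAddMonoid H] (h : G ≅[orderedGroupLang] H)
    {n : ℕ} (hn : 0 < n) :
    HasNDivisibleConvexSubgroup n G ↔ HasNDivisibleConvexSubgroup n H := by
  have key := (realize_divisibleSegmentSentence n G).symm.trans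
    ((elementarilyEquivalent_iff.1 h (divisibleSegmentSentence n)).trans
      (realize_divisibleSegmentSentence n H))
  exact ⟨fun h' => (key.1 h'.hasNDivisibleSegment).hasNDivisibleConvexSubgroup hn,
    fun h' => (key.2 h'.hasNDivisibleSegment).hasNDivisibleConvexSubgroup hn⟩

theorem HasDivisibleConvexSubgroup.hasNDivisibleConvexSubgroup {G : Type u} [AddCommGroup G]
    [LinearOrder G] (h : HasDivisibleConvexSubgroup G) {n : ℕ} (hn : 0 < n) :
    HasNDivisibleConvexSubgroup n G :=
  let ⟨D, hD, hconv, hdiv⟩ := h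
  ⟨D, hD, hconv, hdiv n hn⟩

theorem card_orderedGroupLang_le : orderedGroupLang.card ≤ Cardinal.aleph0 := by
  have h₁ : Countable (Σ n, orderedGroupLang.Functions n) := by
    have (n : ℕ) : Countable (orderedGroupLang.Functions n) :=
      ⟨fun f => match f with
        | OrderedGroupFunc.zero => 0
        | OrderedGroupFunc.neg => 1
        | OrderedGroupFunc.add => 2, fun f g _ => by cases f <;> cases g <;> rfl⟩
    infer_instance
  have h₂ : Countable (Σ n, orderedGroupLang.Relations n) := by
    have (n : ℕ) : Countable (orderedGroupLang.Relations n) :=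
      ⟨fun _ => 0, fun f g _ => by cases f; cases g; rfl⟩
    infer_instance
  have : Countable orderedGroupLang.Symbols := by
    unfold Language.Symbols
    infer_instance
  exact Cardinal.mk_le_aleph0

/-- A countable elementary substructure is a subgroup, and can be moved to any universe. -/
theorem exists_elementarilyEquivalent_group (G : Type u) [AddCommGroup G] [LinearOrder G]
    [IsOrderedAddMonoid G] [Infinite G] :
    ∃ (T : Type v) (_ : AddCommGroup T) (_ : LinearOrder T) (_ : IsOrderedAddMonoid T),
      G ≅[orderedGroupLang] T := by
  obtain ⟨S, -, hS⟩ := exists_elementarySubstructure_card_eq orderedGroupLang (M := G) ∅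
    (Cardinal.aleph0 : Cardinal.{v}) le_rfl (by simp)
    (by simpa using card_orderedGroupLang_le) (by simp)
  have hS' : Cardinal.lift.{v} (Cardinal.mk S) =
      Cardinal.lift.{u} (Cardinal.mk (ULift.{v} ℕ)) := by
    rw [hS]; simp
  -- The carrier is generalized, since the operations of `ULift ℕ` itself must not interfere.
  obtain ⟨T, ⟨e⟩⟩ : ∃ T : Type v, Nonempty (S ≃ T) := ⟨_, Cardinal.lift_mk_eq'.1 hS'⟩
  let K : AddSubgroup G :=
    { carrier := S
      zero_mem' := S.toSubstructure.fun_mem OrderedGroupFunc.zero ![] (fun i => i.elim0)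
      neg_mem' := fun {x} hx => S.toSubstructure.fun_mem OrderedGroupFunc.neg
        ![x] (fun i => by fin_cases i; exact hx)
      add_mem' := fun {x y} hx hy => S.toSubstructure.fun_mem OrderedGroupFunc.add
        ![x, y] (by
        intro i; fin_cases i; exacts [hx, hy]) }
  let e' : T ≃ K := e.symm
  let i₁ : AddCommGroup T := e'.addCommGroup
  let i₂ : LinearOrder T := LinearOrder.lift' e' e'.injective
  have hadd : ∀ a b, e' (a + b) = e' a + e' b := fun a b => e'.apply_symm_apply _
  have hneg : ∀ a, e' (-a) = -e' a := fun a => e'.apply_symm_apply _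
  have hzero : e' 0 = 0 := e'.apply_symm_apply _
  have i₃ : IsOrderedAddMonoid T :=
    { add_le_add_left := fun a b hab c => by
        change e' (a + c) ≤ e' (b + c)
        rw [hadd, hadd]
        exact add_le_add_left (show e' a ≤ e' b from hab) (e' c) }
  refine ⟨T, i₁, i₂, i₃, S.elementarilyEquivalent.symm.trans ?_⟩
  let E : T ≃[orderedGroupLang] S :=
    { toEquiv := e.symm
      map_fun' := fun {n} f x => by
        cases f with
        | zero => exact hzero
        | neg => exact hneg _
        | add => exact hadd _ _
      map_rel' := fun {n} r x => by
        cases r with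
        | le => exact Iff.rfl }
  exact E.toElementaryEmbedding.elementarilyEquivalent.symm

theorem hasNDivisibleConvexSubgroup_of_elementarilyEquivalent {G : Type u} {H : Type v}
    [AddCommGroup G] [LinearOrder G] [IsOrderedAddMonoid G]
    [AddCommGroup H] [LinearOrder H] [IsOrderedAddMonoid H] (h : G ≅[orderedGroupLang] H)
    (hH : HasDivisibleConvexSubgroup H) (p : ℕ) (hp : p.Prime) :
    HasNDivisibleConvexSubgroup p G :=
  (hasNDivisibleConvexSubgroup_iff_of_elementarilyEquivalent h hp.pos).2
    (hH.hasNDivisibleConvexSubgroup hp.pos)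

theorem exists_elementarilyEquivalent_ratSum {G : Type u} [AddCommGroup G] [LinearOrder G]
    [IsOrderedAddMonoid G] (h : ∀ p : ℕ, p.Prime → HasNDivisibleConvexSubgroup p G) :
    ∃ (T : Type v) (_ : AddCommGroup T) (_ : LinearOrder T) (_ : IsOrderedAddMonoid T),
      G ≅[orderedGroupLang] InvLexSum ℚ T := by
  have : Nontrivial G := by
    obtain ⟨a, ha, -⟩ := (h 2 Nat.prime_two).hasNDivisibleSegment
    exact ⟨⟨a, 0, ha.ne'⟩⟩
  have : Infinite G := NoMaxOrder.infinite
  obtain ⟨T, i₁, i₂, i₃, hT⟩ := exists_elementarilyEquivalent_group.{u, v} G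
  refine ⟨T, i₁, i₂, i₃, hT.trans (elementarilyEquivalent_ratSum fun p hp => ?_)⟩
  exact (hasNDivisibleConvexSubgroup_iff_of_elementarilyEquivalent hT hp.pos).1 (h p hp)

end Elementary

theorem mainTheorem11 (Γ : Type u) [AddCommGroup Γ] [LinearOrder Γ] [IsOrderedAddMonoid Γ] :
    List.TFAE [
      ∀ p : ℕ, p.Prime → HasNDivisibleConvexSubgroup p Γ,
      ∃ (Γ' : Type v) (_ : AddCommGroup Γ') (_ : LinearOrder Γ') (_ : IsOrderedAddMonoid Γ'),
        (Γ ≅[orderedGroupLang] Γ') ∧ HasDivisibleConvexSubgroup Γ',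
      Γ ≅[orderedGroupLang] InvLexSum ℚ Γ,
      ∃ (Δ : Type w) (_ : AddCommGroup Δ) (_ : LinearOrder Δ) (_ : IsOrderedAddMonoid Δ),
        Γ ≅[orderedGroupLang] InvLexSum ℚ Δ] := by
  tfae_have 1 → 2 := fun h => by
    obtain ⟨Δ, _, _, _, hΔ⟩ := exists_elementarilyEquivalent_ratSum.{u, v} h
    exact ⟨InvLexSum ℚ Δ, inferInstance, inferInstance, inferInstance, hΔ,
      hasDivisibleConvexSubgroup_ratSum⟩
  tfae_have 1 → 3 := elementarilyEquivalent_ratSum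
  tfae_have 1 → 4 := exists_elementarilyEquivalent_ratSum.{u, w}
  tfae_have 2 → 1 := fun ⟨Γ', _, _, _, hΓ, hD⟩ =>
    hasNDivisibleConvexSubgroup_of_elementarilyEquivalent hΓ hD
  tfae_have 3 → 1 := fun h =>
    hasNDivisibleConvexSubgroup_of_elementarilyEquivalent h hasDivisibleConvexSubgroup_ratSum
  tfae_have 4 → 1 := fun ⟨Δ, _, _, _, h⟩ =>
    hasNDivisibleConvexSubgroup_of_elementarilyEquivalent h hasDivisibleConvexSubgroup_ratSum
  tfae_finish
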